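/- Let $\Gamma=\mathrm{SL}(2,\mathbb Z)$ act on the torus $T^2=(\mathbb R/\mathbb Z)^2$ by $$\begin{pmatrix}a&b\\c&d\end{pmatrix}\cdot(\varepsilon_0,\varepsilon_1)=(a\varepsilon_0-b\varepsilon_1,\,-c\varepsilon_0+d\varepsilon_1),$$ let $A=T^2\rtimes\Gamma$, and let $A^{(3)}=A^3\rtimes S_3$, where $S_3$ permutes the three factors. (The element $((\varepsilon_0,\varepsilon_1),\gamma)\in A$ acts on the universal family of elliptic curves $\mathbb C/(\mathbb Z+\mathbb Z\tau)$ over the upper half plane by $(\tau,z)\mapsto\left(\frac{a\tau+b}{c\tau+d},\frac{z}{c\tau+d}\right)$ followed by $(\tau,z)\mapsto(\tau,z+\varepsilon_0+\varepsilon_1\tau)$.) For $h\in\{0,1,\tau\}$ write $\bar h\in T^2$ for $(0,0)$, $(\tfrac12,0)$, $(0,\tfrac12)$ respectively, and let $h\pm$ denote the element $(\bar h,\pm I)\in A$; it acts on each elliptic curve by $z\mapsto \pm z$, $z\mapsto\pm z+\tfrac12$, $z\mapsto\pm z+\tfrac{\tau}{2}$ for $h=0,1,\tau$ respectively. A triple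 of such symbols denotes an element of $A^3\subset A^{(3)}$, and a triple without signs denotes the corresponding translation (all signs $+$). Let $G\subset A^{(3)}$ be one of the following ten finite groups, given by generators; these are the groups of the Donagi–Wendland classification for which the orbifold $(E_1\times E_2\times E_3)/G$ has $h^{2,1}=3$: - (0-1): $(0+,0-,0-),\ (0-,0+,0-)$; - (0-4): $(1+,0-,0-),\ (0-,1+,1-)$; - (1-1): $(0+,0-,0-),\ (0-,0+,0-),\ (\tau,\tau,\tau)$; - (1-5): $(1+,0-,0-),\ (0-,1+,1-),\ (\tau,\tau,\tau)$; - (1-11): $(1+,0-,0-),\ (0-,1+,1-),\ (\tau,\tau,0)$; - (2-1): $(0+,0-,0-),\ (0-,0+,0-),\ (1,1,1),\ (\tau,\tau,\tau)$; - (2-9): $(0+,0-,0-),\ (0-,0+,0-),\ (0,1,1),\ (1,0,1)$; - (2-12): $(\tau+,0-,0-),\ (0-,\tau+,\tau-),\ (0,1,1),\ (1,0,1)$; - (3-5): $(0+,0-,0-),\ (0-,0+,0-),\ (0,1,1),\ (1,0,1),\ (\tau,\tau,\tau)$; - (4-1): $(0+,0-,0-),\ (0-,0+,0-),\ (0,\tau,1),\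 (\tau,1,0),\ (1,0,\tau),\ (1,1,1)$. Let $H=N_{A^{(3)}}(G)$ be the normalizer of $G$ in $A^{(3)}$, and let $H'=H/G$. Then for every prime $p>3$ the group cohomology $H^2(H',\mathbb Z)$, with trivial action of $H'$ on $\mathbb Z$, has no $p$-torsion: if $x\in H^2(H',\mathbb Z)$ and $px=0$, then $x=0$. -/

import Mathlib

noncomputable section

/-- The real torus `T² = (ℝ/ℤ)²`. A point `(ε₀, ε₁)` acts on `ℂ / (ℤ + ℤ τ)` as the translation
`z ↦ z + ε₀ + ε₁ τ`. -/
abbrev RealTorus : Type := UnitAddCircle × UnitAddCircle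

/-- The endomorphism `(ε₀, ε₁) ↦ (a ε₀ - b ε₁, - c ε₀ + d ε₁)` of `T²` attached to the matrix
`γ = !![a, b; c, d]` in `SL(2, ℤ)`. It describes conjugation of translations by the lift
`(τ, z) ↦ ((a τ + b) / (c τ + d), z / (c τ + d))` of `γ` to the universal family of elliptic
curves over the upper half plane. -/
def torusAct (γ : Matrix.SpecialLinearGroup (Fin 2) ℤ) (ε : RealTorus) : RealTorus :=
  (γ 0 0 • ε.1 - γ 0 1 • ε.2, -(γ 1 0 • ε.1) + γ 1 1 • ε.2)

lemma torusAct_one (ε : RealTorus) : torusAct 1 ε = ε := by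
  simp [torusAct]

lemma torusAct_mul (γ δ : Matrix.SpecialLinearGroup (Fin 2) ℤ) (ε : RealTorus) :
    torusAct (γ * δ) ε = torusAct γ (torusAct δ ε) := by
  ext <;>
    simp only [torusAct, Matrix.SpecialLinearGroup.coe_mul, Matrix.mul_apply, Fin.sum_univ_two] <;>
    module

lemma torusAct_add (γ : Matrix.SpecialLinearGroup (Fin 2) ℤ) (ε ε' : RealTorus) :
    torusAct γ (ε + ε') = torusAct γ ε + torusAct γ ε' := by
  ext <;> simp only [torusAct, Prod.fst_add, Prod.snd_add] <;> module

/-- The action of `Γ = SL(2, ℤ)` on `T²` (written multiplicatively) by automorphisms. -/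
def torusAut :
    Matrix.SpecialLinearGroup (Fin 2) ℤ →* MulAut (Multiplicative RealTorus) where
  toFun γ :=
    { toFun := fun ε => Multiplicative.ofAdd (torusAct γ ε.toAdd)
      invFun := fun ε => Multiplicative.ofAdd (torusAct γ⁻¹ ε.toAdd)
      left_inv := fun ε => by
        simp only [toAdd_ofAdd, ← torusAct_mul, inv_mul_cancel, torusAct_one, ofAdd_toAdd]
      right_inv := fun ε => by
        simp only [toAdd_ofAdd, ← torusAct_mul, mul_inv_cancel, torusAct_one, ofAdd_toAdd]
      map_mul' := fun ε ε' => by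
        simp only [toAdd_mul, torusAct_add, ofAdd_add] }
  map_one' := by
    ext ε : 1
    exact congrArg Multiplicative.ofAdd (torusAct_one ε.toAdd)
  map_mul' γ δ := by
    ext ε : 1
    exact congrArg Multiplicative.ofAdd (torusAct_mul γ δ ε.toAdd)

/-- The group `A = T² ⋊ SL(2, ℤ)`. -/
abbrev GroupA : Type :=
  Multiplicative RealTorus ⋊[torusAut] Matrix.SpecialLinearGroup (Fin 2) ℤ

/-- The group `A⁽³⁾ = A³ ⋊ S₃`, where `S₃` permutes the three factors:
`(σ • a) i = a (σ⁻¹ i)`. -/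
abbrev GroupA3 : Type :=
  (Fin 3 → GroupA) ⋊[(mulAutArrow : Equiv.Perm (Fin 3) →* MulAut (Fin 3 → GroupA))]
    Equiv.Perm (Fin 3)

/-- The translation amounts `0`, `1/2` and `τ/2`, denoted `0`, `1` and `τ`. -/
inductive HalfPeriod
  | zero
  | one
  | tau

/-- The half periods as points of `T²`. -/
def HalfPeriod.toTorus : HalfPeriod → RealTorus
  | .zero => (0, 0)
  | .one => (((1 / 2 : ℝ) : UnitAddCircle), 0)
  | .tau => (0, ((1 / 2 : ℝ) : UnitAddCircle))

/-- The element of `A` acting on each elliptic curve by `z ↦ z + h`. -/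
def plusBy (h : HalfPeriod) : GroupA := ⟨Multiplicative.ofAdd h.toTorus, 1⟩

/-- The element of `A` acting on each elliptic curve by `z ↦ -z + h`. -/
def minusBy (h : HalfPeriod) : GroupA := ⟨Multiplicative.ofAdd h.toTorus, -1⟩

/-- The element of `A⁽³⁾` acting on `E₁ × E₂ × E₃` by `a₁`, `a₂`, `a₃` on the three factors. -/
def triple (a₁ a₂ a₃ : GroupA) : GroupA3 := SemidirectProduct.inl ![a₁, a₂, a₃]

/-- The translation of `E₁ × E₂ × E₃` by the given half periods. -/
def shiftBy (h₁ h₂ h₃ : HalfPeriod) : GroupA3 := triple (plusBy h₁) (plusBy h₂) (plusBy h₃)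

/-- The ten types of orbifolds `X = (E₁ × E₂ × E₃) / G` with `h²¹ = 3` in the classification of
Donagi and Wendland; `type_r_n` is the type with label `(r-n)`, for which `G ≅ (ℤ/2)^(r+2)`. -/
inductive OrbifoldType
  | type_0_1
  | type_0_4
  | type_1_1
  | type_1_5
  | type_1_11
  | type_2_1
  | type_2_9
  | type_2_12
  | type_3_5
  | type_4_1

open HalfPeriod in
/-- The generators of the group `G` of each type: two twists, then the shifts. -/
def orbifoldGenerators : OrbifoldType → Set GroupA3
  | .type_0_1 =>
    {triple (plusBy zero) (minusBy zero) (minusBy zero),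
      triple (minusBy zero) (plusBy zero) (minusBy zero)}
  | .type_0_4 =>
    {triple (plusBy one) (minusBy zero) (minusBy zero),
      triple (minusBy zero) (plusBy one) (minusBy one)}
  | .type_1_1 =>
    {triple (plusBy zero) (minusBy zero) (minusBy zero),
      triple (minusBy zero) (plusBy zero) (minusBy zero),
      shiftBy tau tau tau}
  | .type_1_5 =>
    {triple (plusBy one) (minusBy zero) (minusBy zero),
      triple (minusBy zero) (plusBy one) (minusBy one),
      shiftBy tau tau tau}
  | .type_1_11 =>
    {triple (plusBy one) (minusBy zero) (minusBy zero),
      triple (minusBy zero) (plusBy one) (minusBy one),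
      shiftBy tau tau zero}
  | .type_2_1 =>
    {triple (plusBy zero) (minusBy zero) (minusBy zero),
      triple (minusBy zero) (plusBy zero) (minusBy zero),
      shiftBy one one one, shiftBy tau tau tau}
  | .type_2_9 =>
    {triple (plusBy zero) (minusBy zero) (minusBy zero),
      triple (minusBy zero) (plusBy zero) (minusBy zero),
      shiftBy zero one one, shiftBy one zero one}
  | .type_2_12 =>
    {triple (plusBy tau) (minusBy zero) (minusBy zero),
      triple (minusBy zero) (plusBy tau) (minusBy tau),
      shiftBy zero one one, shiftBy one zero one}
  | .type_3_5 =>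
    {triple (plusBy zero) (minusBy zero) (minusBy zero),
      triple (minusBy zero) (plusBy zero) (minusBy zero),
      shiftBy zero one one, shiftBy one zero one, shiftBy tau tau tau}
  | .type_4_1 =>
    {triple (plusBy zero) (minusBy zero) (minusBy zero),
      triple (minusBy zero) (plusBy zero) (minusBy zero),
      shiftBy zero tau one, shiftBy tau one zero, shiftBy one zero tau, shiftBy one one one}

/-- The finite group `G`, as a subgroup of `A⁽³⁾`. -/
def orbifoldGroup (t : OrbifoldType) : Subgroup GroupA3 :=
  Subgroup.closure (orbifoldGenerators t)

/-- `H = N_{A⁽³⁾}(G)`, the normalizer of `G` in `A⁽³⁾`. -/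
abbrev GroupH (t : OrbifoldType) : Subgroup GroupA3 :=
  Subgroup.normalizer (orbifoldGroup t : Set GroupA3)

/-- The group `H' = H / G`. -/
abbrev GroupHPrime (t : OrbifoldType) : Type :=
  GroupH t ⧸ (orbifoldGroup t).subgroupOf (GroupH t)

end

/-! By the sequence 0 → ℤ → ℤ → ℤ/p → 0, the p-torsion of H²(G, ℤ) is the cokernel of Hom(G, ℤ) →
Hom(G, ℤ/p), so it suffices that every character mod p lifts to ℤ (`LiftsHomsMod`,
`groupCohomology_two_eq_zero`). This property holds for free groups and passes to finite products,
to quotients by subgroups of finite exponent, from subgroups of index prime to p (by transfer), and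
from a split quotient whose kernel has exponent prime to p.

All ten groups are treated at once. Only two facts about G matter: it consists of maps z ↦ ±z + h
with h of order dividing 2, and each coordinate is negated by some element of G. By the first, Γ(2)³
centralizes G; by the second, a translation normalizing G is killed by 4. Hence the part of H with
trivial image in S₃ and in SL(2, ℤ/2)³ is a split extension of Γ(2)³ by a group of exponent dividing
4. Its index in H has only the prime factors 2 and 3, and Γ(2) has a free subgroup of index 2. -/

/-! ### Lifting characters mod p, and H². -/

/-- Every homomorphism from `G` to `ℤ/p` lifts to a homomorphism from `G` to `ℤ`. -/
def LiftsHomsMod (p : ℕ) (G : Type*) [Group G] : Prop :=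
  ∀ f : G →* Multiplicative (ZMod p), ∃ F : G →* Multiplicative ℤ,
    (Int.castAddHom (ZMod p)).toMultiplicative.comp F = f

lemma MonoidHom.map_transfer {G A B : Type*} [Group G] [CommGroup A] [CommGroup B]
    {K : Subgroup G} [K.FiniteIndex] (φ : K →* A) (h : A →* B) (g : G) :
    h (φ.transfer g) = (h.comp φ).transfer g := by
  simp [MonoidHom.transfer_def _ default, Subgroup.leftTransversals.diff, map_prod]

/-- Since g permutes the cosets, the values of f on the representatives cancel, leaving one factor f
g per coset. -/
lemma MonoidHom.transfer_restrict {G A : Type*} [Group G] [CommGroup A]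
    (K : Subgroup G) [K.FiniteIndex] (f : G →* A) (g : G) :
    (f.comp K.subtype).transfer g = f g ^ K.index := by
  classical
  let _ := K.fintypeQuotientOfFiniteIndex
  let T : K.LeftTransversal := default
  have hperm : ∏ q : G ⧸ K, f (T.2.leftQuotientEquiv (g⁻¹ • q)) =
      ∏ q : G ⧸ K, f (T.2.leftQuotientEquiv q) :=
    Fintype.prod_equiv (MulAction.toPerm g⁻¹) _ _ fun _ => rfl
  rw [MonoidHom.transfer_def _ T, Subgroup.leftTransversals.diff]
  simp only [MonoidHom.comp_apply, Subgroup.subtype_apply, map_mul, map_inv,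
    Subgroup.smul_apply_eq_smul_apply_inv_smul, smul_eq_mul, Finset.prod_mul_distrib,
    Finset.prod_inv_distrib, hperm, Finset.prod_const, Finset.card_univ]
  rw [Subgroup.index, Nat.card_eq_fintype_card, mul_left_comm, inv_mul_cancel, mul_one]

namespace LiftsHomsMod

variable {p : ℕ}

/-- The lifting property passes up from a subgroup of index coprime to `p`, by transfer. -/
lemma of_subgroup {G : Type*} [Group G] (K : Subgroup G) [K.FiniteIndex]
    (hK : p.Coprime K.index) (h : LiftsHomsMod p K) : LiftsHomsMod p G := by
  intro f
  obtain ⟨F, hF⟩ := h (f.comp K.subtype)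
  -- Mod p the transfer of F is f to the power of the index, so an integer inverse of the index mod
  -- p corrects it.
  refine ⟨F.transfer ^ ((K.index : ZMod p)⁻¹.cast : ℤ), ?_⟩
  ext g
  rw [MonoidHom.comp_apply, MonoidHom.zpow_apply, map_zpow, MonoidHom.map_transfer, hF,
    MonoidHom.transfer_restrict]
  apply Multiplicative.toAdd.injective
  have hinv : ((K.index : ZMod p)⁻¹) * (K.index : ZMod p) = 1 := by
    rw [mul_comm]; exact ZMod.coe_mul_inv_eq_one _ hK.symm
  rw [toAdd_zpow, toAdd_pow, zsmul_eq_mul, nsmul_eq_mul, ZMod.intCast_cast, ZMod.cast_id,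
    ← mul_assoc, hinv, one_mul]

/-- The lifting property passes up from the kernel of a homomorphism to a finite group of order
coprime to `p`. -/
lemma of_ker {G Q : Type*} [Group G] [Group Q] [Finite Q] (φ : G →* Q)
    (hQ : p.Coprime (Nat.card Q)) (h : LiftsHomsMod p φ.ker) : LiftsHomsMod p G := by
  have : φ.ker.FiniteIndex := Subgroup.finiteIndex_ker φ
  refine of_subgroup φ.ker (hQ.coprime_dvd_right ?_) h
  rw [Subgroup.index_ker]
  exact Subgroup.card_subgroup_dvd_card _

lemma of_mulEquiv {G Q : Type*} [Group G] [Group Q] (e : G ≃* Q) (h : LiftsHomsMod p Q) :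
    LiftsHomsMod p G := by
  intro f
  obtain ⟨F, hF⟩ := h (f.comp e.symm.toMonoidHom)
  refine ⟨F.comp e.toMonoidHom, ?_⟩
  rw [← MonoidHom.comp_assoc, hF]
  ext g
  simp

/-- The lifting property passes up from a split quotient whose kernel has exponent coprime
to `p`. -/
lemma of_split {E Q : Type*} [Group E] [Group Q] (π : E →* Q) (s : Q →* E)
    (hs : ∀ q, π (s q) = q) {n : ℕ} (hn : p.Coprime n) (hker : ∀ x, π x = 1 → x ^ n = 1)
    (h : LiftsHomsMod p Q) : LiftsHomsMod p E := by
  intro f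
  obtain ⟨F, hF⟩ := h (f.comp s)
  refine ⟨F.comp π, ?_⟩
  rw [← MonoidHom.comp_assoc, hF]
  ext x
  -- This element lies in the kernel of π, so its image under f is killed by both n and p.
  have h1 : f (x * (s (π x))⁻¹) = 1 := by
    have hpow : f (x * (s (π x))⁻¹) ^ n = 1 := by
      rw [← map_pow, hker _ (by simp [hs]), map_one]
    have hp : f (x * (s (π x))⁻¹) ^ p = 1 := by
      apply Multiplicative.toAdd.injective
      simp
    simpa [hn.gcd_eq_one] using pow_gcd_eq_one.2 ⟨hp, hpow⟩
  rw [map_mul, map_inv, mul_inv_eq_one] at h1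
  exact h1.symm

/-- A lift to ℤ kills N automatically, because ℤ is torsion-free. -/
lemma quotient {G : Type*} [Group G] (N : Subgroup G) [N.Normal] {n : ℕ} (hn : n ≠ 0)
    (hN : ∀ x ∈ N, x ^ n = 1) (h : LiftsHomsMod p G) : LiftsHomsMod p (G ⧸ N) := by
  intro f
  obtain ⟨F, hF⟩ := h (f.comp (QuotientGroup.mk' N))
  refine ⟨QuotientGroup.lift N F fun x hx => ?_, ?_⟩
  · have : F x ^ n = 1 := by rw [← map_pow, hN x hx, map_one]
    exact (pow_eq_one_iff_left hn).1 this
  · ext x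
    exact DFunLike.congr_fun hF x

lemma pi {ι : Type*} [Fintype ι] {G : ι → Type*} [∀ i, Group (G i)]
    (h : ∀ i, LiftsHomsMod p (G i)) : LiftsHomsMod p (∀ i, G i) := by
  classical
  intro f
  choose F hF using fun i => h i (f.comp (MonoidHom.mulSingle G i))
  refine ⟨∏ i, (F i).comp (Pi.evalMonoidHom G i), ?_⟩
  refine MonoidHom.pi_ext fun i x => ?_
  have hx := DFunLike.congr_fun (hF i) x
  simp only [MonoidHom.comp_apply] at hx ⊢
  rw [MonoidHom.finsetProd_apply, Finset.prod_eq_single i]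
  · simpa using hx
  · intro j _ hj
    simp [hj]
  · simp

lemma freeGroup (ι : Type*) : LiftsHomsMod p (FreeGroup ι) := by
  intro f
  refine ⟨FreeGroup.lift fun i => Multiplicative.ofAdd
    ((Multiplicative.toAdd (f (FreeGroup.of i))).cast : ℤ), ?_⟩
  ext i
  simp

/-- If homomorphisms to `ℤ/p` lift to `ℤ`, then `H²(G, ℤ)` has no `p`-torsion. -/
lemma groupCohomology_two_eq_zero {G : Type} [Group G] (hp : p ≠ 0) (h : LiftsHomsMod p G)
    (x : groupCohomology (Rep.trivial ℤ G ℤ) 2) (hx : p • x = 0) : x = 0 := by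
  induction x using groupCohomology.H2_induction_on with | h c => ?_
  rw [← map_nsmul, groupCohomology.H2π_eq_zero_iff] at hx
  rw [groupCohomology.H2π_eq_zero_iff]
  obtain ⟨b, hb⟩ := hx
  change G → ℤ at b
  have hb' : ∀ g k : G, b k - b (g * k) + b g = p * c (g, k) := by
    intro g k
    rw [← nsmul_eq_mul]
    exact congrFun hb (g, k)
  -- The coboundary of b is p • c, so b is additive mod p.
  let f : G →* Multiplicative (ZMod p) :=
    MonoidHom.mk' (fun g => Multiplicative.ofAdd (b g : ZMod p)) <| by
    intro g k
    rw [← ofAdd_add]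
    congr 1
    have := congrArg (Int.cast : ℤ → ZMod p) (hb' g k)
    push_cast at this
    rw [CharP.cast_eq_zero, zero_mul] at this
    linear_combination -this
  obtain ⟨F, hF⟩ := h f
  have hdvd : ∀ g, (p : ℤ) ∣ b g - (F g).toAdd := by
    intro g
    have := congrArg Multiplicative.toAdd (DFunLike.congr_fun hF g)
    rw [← ZMod.intCast_zmod_eq_zero_iff_dvd, Int.cast_sub, sub_eq_zero]
    exact this.symm
  -- With b' = (b - F) / p, the homomorphism F has zero coboundary, so b' bounds c.
  choose b' hb'' using hdvd
  refine ⟨b', funext fun gk => ?_⟩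
  obtain ⟨g, k⟩ := gk
  have hp' : (p : ℤ) ≠ 0 := by exact_mod_cast hp
  apply mul_left_cancel₀ hp'
  rw [← hb' g k]
  have hF' : (F (g * k)).toAdd = (F g).toAdd + (F k).toAdd := by rw [map_mul, toAdd_mul]
  change (p : ℤ) * (b' k - b' (g * k) + b' g) = _
  linear_combination -(hb'' g) - (hb'' k) + hb'' (g * k) + hF'

end LiftsHomsMod
-- Sanov's free subgroup of index 2 in Γ(2).
open Matrix CongruenceSubgroup

/-- The upper unitriangular generator of the Sanov subgroup. -/
def sanovUpper : SpecialLinearGroup (Fin 2) ℤ := ⟨!![1, 2; 0, 1], by simp⟩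

/-- The lower unitriangular generator of the Sanov subgroup. -/
def sanovLower : SpecialLinearGroup (Fin 2) ℤ := ⟨!![1, 0; 2, 1], by simp⟩

lemma mem_Gamma_two {γ : SpecialLinearGroup (Fin 2) ℤ} :
    γ ∈ Gamma 2 ↔ Odd (γ 0 0) ∧ Even (γ 0 1) ∧ Even (γ 1 0) ∧ Odd (γ 1 1) := by
  have h1 : ∀ a : ℤ, (a : ZMod 2) = 1 ↔ Odd a := fun a => ZMod.intCast_eq_one_iff_odd
  have h0 : ∀ a : ℤ, (a : ZMod 2) = 0 ↔ Even a := fun a => ZMod.intCast_eq_zero_iff_even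
  rw [Gamma_mem, h1, h0, h0, h1]

/-- The generators of the Sanov subgroup, as elements of `Γ(2)`. -/
def sanovGenerator : Bool → Gamma 2
  | true => ⟨sanovUpper, by rw [mem_Gamma_two]; decide⟩
  | false => ⟨sanovLower, by rw [mem_Gamma_two]; decide⟩


lemma coe_sanovGenerator_true : ((sanovGenerator true).1 : Matrix (Fin 2) (Fin 2) ℤ) =
    !![1, 2; 0, 1] := rfl

lemma coe_sanovGenerator_false : ((sanovGenerator false).1 : Matrix (Fin 2) (Fin 2) ℤ) =
    !![1, 0; 2, 1] := rfl

lemma coe_sanovGenerator_true_inv :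
    ((sanovGenerator true)⁻¹.1 : Matrix (Fin 2) (Fin 2) ℤ) = !![1, -2; 0, 1] := by
  simp [coe_sanovGenerator_true, adjugate_fin_two]

lemma coe_sanovGenerator_false_inv :
    ((sanovGenerator false)⁻¹.1 : Matrix (Fin 2) (Fin 2) ℤ) = !![1, 0; -2, 1] := by
  simp [coe_sanovGenerator_false, adjugate_fin_two]

lemma Gamma_two_coe_mul (γ δ : Gamma 2) :
    ((γ * δ).1 : Matrix (Fin 2) (Fin 2) ℤ) = γ.1 * δ.1 := rfl

lemma Gamma_two_mul_apply (γ δ : Gamma 2) (i j : Fin 2) :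
    (γ * δ).1 i j = γ.1 i 0 * δ.1 0 j + γ.1 i 1 * δ.1 1 j := by
  simp [Matrix.mul_apply]

/-- The elements of `Γ(2)` with diagonal entries congruent to `1` modulo `4`. -/
def sanovSubgroup : Subgroup (Gamma 2) where
  carrier := {γ | (4 : ℤ) ∣ γ.1 0 0 - 1}
  one_mem' := by simp
  mul_mem' {γ δ} hγ hδ := by
    obtain ⟨b, hb⟩ := (mem_Gamma_two.1 γ.2).2.1.two_dvd
    obtain ⟨c, hc⟩ := (mem_Gamma_two.1 δ.2).2.2.1.two_dvd
    obtain ⟨k, hk⟩ := hγ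
    obtain ⟨l, hl⟩ := hδ
    refine ⟨k * δ.1 0 0 + l + b * c, ?_⟩
    rw [Gamma_two_mul_apply, hb, hc]
    linear_combination (δ.1 0 0) * hk + hl
  inv_mem' {γ} hγ := by
    obtain ⟨b, hb⟩ := (mem_Gamma_two.1 γ.2).2.1.two_dvd
    obtain ⟨c, hc⟩ := (mem_Gamma_two.1 γ.2).2.2.1.two_dvd
    obtain ⟨k, hk⟩ := hγ
    have hdet := γ.1.det_coe
    rw [det_fin_two, hb, hc] at hdet
    refine ⟨b * c - k * γ.1 1 1, ?_⟩
    have hinv : (γ⁻¹).1 0 0 = γ.1 1 1 := by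
      rw [Subgroup.coe_inv, SpecialLinearGroup.SL2_inv_expl]
      rfl
    rw [hinv]
    linear_combination hdet - (γ.1 1 1) * hk

lemma mem_sanovSubgroup {γ : Gamma 2} : γ ∈ sanovSubgroup ↔ (4 : ℤ) ∣ γ.1 0 0 - 1 := Iff.rfl

lemma sanovSubgroup_index : sanovSubgroup.index = 2 := by
  rw [Subgroup.index_eq_two_iff]
  -- Multiplication by -1 exchanges the classes 1 and 3 mod 4 of the odd upper left entry.
  refine ⟨⟨-1, by rw [mem_Gamma_two]; decide⟩, fun γ => ?_⟩
  have hodd := (mem_Gamma_two.1 γ.2).1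
  rw [mem_sanovSubgroup, mem_sanovSubgroup]
  simp only [Subgroup.coe_mul, mul_neg, mul_one, SpecialLinearGroup.coe_neg, neg_apply]
  rw [xor_iff_iff_not]
  obtain ⟨k, hk⟩ := hodd
  omega

lemma sanovGenerator_mem (i : Bool) : sanovGenerator i ∈ sanovSubgroup := by
  rw [mem_sanovSubgroup]
  cases i
  · simp [coe_sanovGenerator_false]
  · simp [coe_sanovGenerator_true]

/-- Euclidean descent on the first column (a, c), with even quotients; n bounds |a| + |c|. -/
lemma mem_range_of_mem_sanovSubgroup (n : ℕ) (γ : Gamma 2) (hγ : γ ∈ sanovSubgroup)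
    (hn : (γ.1 0 0).natAbs + (γ.1 1 0).natAbs ≤ n) :
    γ ∈ (FreeGroup.lift sanovGenerator).range := by
  have hgen : ∀ i, sanovGenerator i ∈ (FreeGroup.lift sanovGenerator).range := fun i =>
    ⟨FreeGroup.of i, by simp⟩
  induction n generalizing γ with
  | zero =>
    rw [mem_sanovSubgroup] at hγ
    omega
  | succ n ih =>
    have key : ∀ i : Bool, ∀ g ∈ ({sanovGenerator i, (sanovGenerator i)⁻¹} : Set (Gamma 2)),
        ((g * γ).1 0 0).natAbs + ((g * γ).1 1 0).natAbs ≤ n →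
          γ ∈ (FreeGroup.lift sanovGenerator).range := by
      intro i g hg hlt
      obtain ⟨hg1, hg2⟩ : g ∈ (FreeGroup.lift sanovGenerator).range ∧ g ∈ sanovSubgroup := by
        rcases hg with rfl | rfl
        · exact ⟨hgen i, sanovGenerator_mem i⟩
        · exact ⟨inv_mem (hgen i), inv_mem (sanovGenerator_mem i)⟩
      exact (Subgroup.mul_mem_cancel_left _ hg1).1 (ih _ (mul_mem hg2 hγ) hlt)
    have k1 := key true _ (Or.inl rfl)
    have k2 := key true _ (Or.inr rfl)
    have k3 := key false _ (Or.inl rfl)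
    have k4 := key false _ (Or.inr rfl)
    simp only [Gamma_two_mul_apply, coe_sanovGenerator_true, coe_sanovGenerator_true_inv,
      coe_sanovGenerator_false, coe_sanovGenerator_false_inv, of_apply, cons_val', cons_val_zero,
      cons_val_one, cons_val_fin_one, one_mul, zero_mul, add_zero, zero_add] at k1 k2 k3 k4
    obtain ⟨b, hb⟩ := (mem_Gamma_two.1 γ.2).2.1.two_dvd
    obtain ⟨c, hc⟩ := (mem_Gamma_two.1 γ.2).2.2.1.two_dvd
    have hdet := γ.1.det_coe
    rw [det_fin_two] at hdet
    rw [mem_sanovSubgroup] at hγ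
    by_cases h0 : γ.1 1 0 = 0
    · have ha : γ.1 0 0 = 1 := by
        rw [h0, mul_zero, sub_zero] at hdet
        rcases Int.isUnit_iff.1 (IsUnit.of_mul_eq_one _ hdet) with h | h
        · exact h
        -- The condition mod 4 excludes a = -1.
        · rw [h] at hγ; norm_num at hγ
      have hd : γ.1 1 1 = 1 := by
        rw [h0, ha] at hdet
        linarith
      have hpow : ∀ m : ℤ, ((sanovGenerator true ^ m).1 : Matrix (Fin 2) (Fin 2) ℤ) =
          !![1, 2 * m; 0, 1] := by
        intro m
        induction m using Int.induction_on with
        | zero => simp [one_fin_two]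
        | succ m ih =>
          rw [_root_.zpow_add_one, Gamma_two_coe_mul, ih,
            coe_sanovGenerator_true]
          simp
          ring
        | pred m ih =>
          rw [_root_.zpow_sub_one, Gamma_two_coe_mul, ih,
            coe_sanovGenerator_true_inv]
          simp
          ring
      have : γ = sanovGenerator true ^ b := by
        apply Subtype.ext
        apply Subtype.ext
        rw [hpow, eta_fin_two (γ.1 : Matrix (Fin 2) (Fin 2) ℤ), ha, hb, h0, hd]
      rw [this]
      exact zpow_mem (hgen true) b
    -- As a is odd and c is even and nonzero, |a| ≠ |c|; adding ±2 times the smaller entry to the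
    -- larger one, with the right sign, shortens the column.
    · by_contra hcon
      replace k1 := mt k1 hcon
      replace k2 := mt k2 hcon
      replace k3 := mt k3 hcon
      replace k4 := mt k4 hcon
      omega

lemma range_lift_sanovGenerator : (FreeGroup.lift sanovGenerator).range = sanovSubgroup := by
  apply le_antisymm
  · rw [FreeGroup.range_lift_eq_closure, Subgroup.closure_le]
    rintro _ ⟨i, rfl⟩
    exact sanovGenerator_mem i
  · exact fun γ hγ => mem_range_of_mem_sanovSubgroup _ γ hγ le_rfl

lemma abs_lt_abs_add_two_mul {x y : ℤ} (hy : y ≠ 0) (h : |x| < |y| ∨ 0 ≤ x * y) :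
    |y| < |x + 2 * y| ∧ 0 < (x + 2 * y) * y := by
  wlog hpos : 0 < y generalizing x y
  · have := @this (-x) (-y) (neg_ne_zero.2 hy) (by simpa using h) (by omega)
    rwa [abs_neg, mul_neg, ← neg_add, abs_neg, neg_mul_neg] at this
  have hx : -y < x := by
    rcases h with h | h
    · rw [abs_of_pos hpos] at h
      exact (abs_lt.1 h).1
    · linarith [nonneg_of_mul_nonneg_left h hpos]
  rw [abs_of_pos hpos, abs_of_pos (by linarith)]
  exact ⟨by linarith, mul_pos (by linarith) hpos⟩

lemma abs_lt_abs_sub_two_mul {x y : ℤ} (hy : y ≠ 0) (h : |x| < |y| ∨ x * y ≤ 0) :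
    |y| < |-2 * y + x| ∧ (-2 * y + x) * y < 0 := by
  have := @abs_lt_abs_add_two_mul (-x) y hy (by simpa using h)
  rw [show -x + 2 * y = -(-2 * y + x) by ring, abs_neg, neg_mul (-2 * y + x), neg_pos] at this
  exact this

lemma injective_lift_sanovGenerator : Function.Injective (FreeGroup.lift sanovGenerator) := by
  -- Ping-pong on the first column (a, c): the larger entry selects the generator, the sign of a * c
  -- its exponent. The case c = 0 goes into `X true`, whence the weak inequality there.
  let X : Bool → Set (Gamma 2)
    | true => {γ | |γ.1 1 0| < |γ.1 0 0| ∧ 0 ≤ γ.1 0 0 * γ.1 1 0}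
    | false => {γ | |γ.1 0 0| < |γ.1 1 0| ∧ 0 < γ.1 0 0 * γ.1 1 0}
  let Y : Bool → Set (Gamma 2)
    | true => {γ | |γ.1 1 0| < |γ.1 0 0| ∧ γ.1 0 0 * γ.1 1 0 < 0}
    | false => {γ | |γ.1 0 0| < |γ.1 1 0| ∧ γ.1 0 0 * γ.1 1 0 < 0}
  have hXne : ∀ i, (X i).Nonempty := by
    rintro (_ | _)
    · exact ⟨sanovGenerator false * sanovGenerator true, by
        simp [X, coe_sanovGenerator_false, coe_sanovGenerator_true]⟩
    · exact ⟨1, by simp [X]⟩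
  have hodd : ∀ γ : Gamma 2, γ.1 0 0 ≠ 0 ∧ |γ.1 0 0| ≠ |γ.1 1 0| := by
    intro γ
    obtain ⟨k, hk⟩ := (mem_Gamma_two.1 γ.2).1
    obtain ⟨c, hc⟩ := (mem_Gamma_two.1 γ.2).2.2.1.two_dvd
    rw [Ne, Ne, abs_eq_abs, hk, hc]
    omega
  refine FreeGroup.injective_lift_of_ping_pong sanovGenerator X Y hXne ?_ ?_ ?_ ?_ ?_
  · rintro (_ | _) (_ | _) h
    · exact absurd rfl h
    · exact Set.disjoint_left.2 fun γ h1 h2 => lt_asymm h1.1 h2.1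
    · exact Set.disjoint_left.2 fun γ h1 h2 => lt_asymm h1.1 h2.1
    · exact absurd rfl h
  · rintro (_ | _) (_ | _) h
    · exact absurd rfl h
    · exact Set.disjoint_left.2 fun γ h1 h2 => lt_asymm h1.1 h2.1
    · exact Set.disjoint_left.2 fun γ h1 h2 => lt_asymm h1.1 h2.1
    · exact absurd rfl h
  · rintro (_ | _) (_ | _)
    · exact Set.disjoint_left.2 fun γ h1 h2 => lt_asymm h1.2 h2.2
    · exact Set.disjoint_left.2 fun γ h1 h2 => lt_asymm h1.1 h2.1
    · exact Set.disjoint_left.2 fun γ h1 h2 => lt_asymm h1.1 h2.1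
    · exact Set.disjoint_left.2 fun γ h1 h2 => not_lt_of_ge h1.2 h2.2
  · rintro (_ | _) _ ⟨γ, hγ, rfl⟩
    · obtain ⟨h0, hne⟩ := hodd γ
      simp only [Y, Set.mem_compl_iff, Set.mem_ofPred_eq, not_and_or, not_lt] at hγ
      simp only [X, Set.mem_ofPred_eq, smul_eq_mul, Gamma_two_mul_apply, coe_sanovGenerator_false,
        of_apply, cons_val', cons_val_zero, cons_val_one, cons_val_fin_one, one_mul, zero_mul,
        add_zero]
      have := abs_lt_abs_add_two_mul (x := γ.1 1 0) h0
        (hγ.imp (fun h => lt_of_le_of_ne h hne.symm) (by rw [mul_comm]; exact id))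
      rwa [add_comm, mul_comm (γ.1 0 0)]
    · obtain ⟨h0, hne⟩ := hodd γ
      simp only [Y, Set.mem_compl_iff, Set.mem_ofPred_eq, not_and_or, not_lt] at hγ
      simp only [X, Set.mem_ofPred_eq, smul_eq_mul, Gamma_two_mul_apply, coe_sanovGenerator_true,
        of_apply, cons_val', cons_val_zero, cons_val_one, cons_val_fin_one, one_mul, zero_mul,
        zero_add]
      by_cases hc : γ.1 1 0 = 0
      · simpa [hc] using h0
      · exact (abs_lt_abs_add_two_mul hc
          (hγ.imp_left fun h => lt_of_le_of_ne h hne)).imp_right le_of_lt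
  · rintro (_ | _) _ ⟨γ, hγ, rfl⟩
    · obtain ⟨h0, hne⟩ := hodd γ
      simp only [X, Set.mem_compl_iff, Set.mem_ofPred_eq, not_and_or, not_lt] at hγ
      simp only [Y, Set.mem_ofPred_eq, smul_eq_mul, Gamma_two_mul_apply, Pi.inv_apply,
        coe_sanovGenerator_false_inv, of_apply, cons_val', cons_val_zero, cons_val_one, cons_val_fin_one, one_mul, zero_mul,
        add_zero]
      have := abs_lt_abs_sub_two_mul (x := γ.1 1 0) h0
        (hγ.imp (fun h => lt_of_le_of_ne h hne.symm) (by rw [mul_comm]; exact id))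
      rwa [mul_comm (γ.1 0 0)]
    · obtain ⟨h0, hne⟩ := hodd γ
      simp only [X, Set.mem_compl_iff, Set.mem_ofPred_eq, not_and_or, not_lt, not_le] at hγ
      simp only [Y, Set.mem_ofPred_eq, smul_eq_mul, Gamma_two_mul_apply, Pi.inv_apply,
        coe_sanovGenerator_true_inv, of_apply, cons_val', cons_val_zero, cons_val_one, cons_val_fin_one, one_mul, zero_mul,
        zero_add]
      have hc : γ.1 1 0 ≠ 0 := by
        intro hc
        simp [hc, h0] at hγ
      rw [add_comm]
      exact abs_lt_abs_sub_two_mul hc (hγ.imp (fun h => lt_of_le_of_ne h hne) le_of_lt)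

lemma LiftsHomsMod.gamma_two {p : ℕ} (hp : p.Coprime 2) : LiftsHomsMod p (Gamma 2) := by
  have : sanovSubgroup.FiniteIndex := ⟨by rw [sanovSubgroup_index]; decide⟩
  refine .of_subgroup sanovSubgroup (by rwa [sanovSubgroup_index]) ?_
  rw [← range_lift_sanovGenerator]
  exact .of_mulEquiv (MonoidHom.ofInjective injective_lift_sanovGenerator).symm (.freeGroup Bool)
-- How 2-torsion points, Γ(2) and translations interact with G.
lemma torusAut_neg_one (ε : Multiplicative RealTorus) : torusAut (-1) ε = ε⁻¹ := by
  apply Multiplicative.toAdd.injective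
  change torusAct (-1) ε.toAdd = -ε.toAdd
  ext <;> simp [torusAct]

/-- The matrix is the identity mod 2, so it differs from the identity by even multiples, which kill
ε. -/
lemma torusAut_eq_self {γ : SpecialLinearGroup (Fin 2) ℤ} (hγ : γ ∈ Gamma 2)
    {ε : Multiplicative RealTorus} (hε : ε ^ 2 = 1) : torusAut γ ε = ε := by
  apply Multiplicative.toAdd.injective
  change torusAct γ ε.toAdd = ε.toAdd
  have h : 2 • ε.toAdd = 0 := congrArg Multiplicative.toAdd hε
  have h1 : 2 • ε.toAdd.1 = 0 := congrArg Prod.fst h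
  have h2 : 2 • ε.toAdd.2 = 0 := congrArg Prod.snd h
  obtain ⟨⟨a, ha⟩, ⟨b, hb⟩, ⟨c, hc⟩, ⟨d, hd⟩⟩ := mem_Gamma_two.1 hγ
  have hk : ∀ (k : ℤ) {x : UnitAddCircle}, 2 • x = 0 → (2 * k) • x = 0 := by
    intro k x hx
    rw [mul_comm, mul_smul, ofNat_zsmul, hx, smul_zero]
  ext
  · simp [torusAct, ha, hb, ← two_mul, add_smul, hk _ h1, hk _ h2]
  · simp [torusAct, hc, hd, ← two_mul, add_smul, hk _ h1, hk _ h2]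

/-- The elements of `A` acting as `z ↦ ± z + h` with `h` a `2`-torsion point. -/
def signedTwoTorsion : Subgroup GroupA where
  carrier := {a | a.left ^ 2 = 1 ∧ (a.right = 1 ∨ a.right = -1)}
  one_mem' := by simp
  mul_mem' {a b} ha hb := by
    refine ⟨?_, ?_⟩
    · rw [SemidirectProduct.mul_left, mul_pow, ha.1, ← map_pow, hb.1, map_one, one_mul]
    · rw [SemidirectProduct.mul_right]
      rcases ha.2 with h | h <;> rcases hb.2 with h' | h' <;> simp [h, h']
  inv_mem' {a} ha := by
    refine ⟨?_, ?_⟩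
    · rw [SemidirectProduct.inv_left, ← map_pow, inv_pow, ha.1, inv_one, map_one]
    · rw [SemidirectProduct.inv_right]
      rcases ha.2 with h | h <;> simp [h]

lemma sq_eq_one_of_mem_signedTwoTorsion {a : GroupA} (ha : a ∈ signedTwoTorsion) : a ^ 2 = 1 := by
  obtain ⟨h1, h2⟩ := ha
  rw [sq] at h1 ⊢
  ext1
  · rw [SemidirectProduct.mul_left]
    rcases h2 with h | h
    · rw [h, map_one]; exact h1
    · rw [h, torusAut_neg_one, mul_inv_cancel]; rfl
  · rw [SemidirectProduct.mul_right]
    rcases h2 with h | h <;> simp [h]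

lemma commute_inr_of_mem_signedTwoTorsion {γ : SpecialLinearGroup (Fin 2) ℤ} (hγ : γ ∈ Gamma 2)
    {a : GroupA} (ha : a ∈ signedTwoTorsion) :
    (SemidirectProduct.inr γ : GroupA) * a = a * SemidirectProduct.inr γ := by
  ext1
  · simp [torusAut_eq_self hγ ha.1]
  · rcases ha.2 with h | h <;> simp [h]

lemma HalfPeriod.sq_ofAdd_toTorus (h : HalfPeriod) : Multiplicative.ofAdd h.toTorus ^ 2 = 1 := by
  have half : (2 : ℕ) • (((1 / 2 : ℝ) : UnitAddCircle)) = 0 := by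
    rw [← AddCircle.coe_nsmul, AddCircle.coe_eq_zero_iff]
    exact ⟨1, by norm_num⟩
  have : (2 : ℕ) • h.toTorus = 0 := by
    cases h <;> simp only [HalfPeriod.toTorus, Prod.smul_mk, half, smul_zero] <;> rfl
  rw [← ofAdd_nsmul, this, ofAdd_zero]

lemma plusBy_mem_signedTwoTorsion (h : HalfPeriod) : plusBy h ∈ signedTwoTorsion :=
  ⟨h.sq_ofAdd_toTorus, Or.inl rfl⟩

lemma minusBy_mem_signedTwoTorsion (h : HalfPeriod) : minusBy h ∈ signedTwoTorsion :=
  ⟨h.sq_ofAdd_toTorus, Or.inr rfl⟩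

/-- The product of three copies of `signedTwoTorsion`, as a subgroup of `A⁽³⁾`. -/
def signedTwoTorsionPi : Subgroup GroupA3 :=
  (Subgroup.pi Set.univ fun _ => signedTwoTorsion).map SemidirectProduct.inl

lemma inl_mem_signedTwoTorsionPi {x : Fin 3 → GroupA} :
    (SemidirectProduct.inl x : GroupA3) ∈ signedTwoTorsionPi ↔ ∀ i, x i ∈ signedTwoTorsion := by
  rw [signedTwoTorsionPi, Subgroup.mem_map_iff_mem SemidirectProduct.inl_injective]
  simp [Subgroup.mem_pi]

lemma triple_mem_signedTwoTorsionPi {a b c : GroupA} (ha : a ∈ signedTwoTorsion)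
    (hb : b ∈ signedTwoTorsion) (hc : c ∈ signedTwoTorsion) :
    triple a b c ∈ signedTwoTorsionPi := by
  rw [triple, inl_mem_signedTwoTorsionPi]
  intro i
  fin_cases i <;> assumption

lemma orbifoldGroup_le (t : OrbifoldType) : orbifoldGroup t ≤ signedTwoTorsionPi := by
  rw [orbifoldGroup, Subgroup.closure_le]
  cases t <;>
  simp [orbifoldGenerators, Set.insert_subset_iff, shiftBy, triple_mem_signedTwoTorsionPi,
    plusBy_mem_signedTwoTorsion, minusBy_mem_signedTwoTorsion]

/-- Every orbifold group contains twists negating the last two coordinates and the first and the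
last coordinate. -/
lemma exists_twists (t : OrbifoldType) : ∃ h h' h'' k k' k'' : HalfPeriod,
    triple (plusBy h) (minusBy h') (minusBy h'') ∈ orbifoldGroup t ∧
    triple (minusBy k) (plusBy k') (minusBy k'') ∈ orbifoldGroup t := by
  cases t <;>
  exact ⟨_, _, _, _, _, _, Subgroup.subset_closure (Or.inl rfl),
    Subgroup.subset_closure (Or.inr (by first | exact rfl | exact Or.inl rfl))⟩

lemma exists_minusBy (t : OrbifoldType) (i : Fin 3) : ∃ (y : Fin 3 → GroupA) (h : HalfPeriod),
    SemidirectProduct.inl y ∈ orbifoldGroup t ∧ y i = minusBy h := by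
  obtain ⟨h, h', h'', k, k', k'', h1, h2⟩ := exists_twists t
  fin_cases i
  · exact ⟨_, k, h2, rfl⟩
  · exact ⟨_, h', h1, rfl⟩
  · exact ⟨_, h'', h1, rfl⟩

lemma inl_commutator_minusBy (ε : Multiplicative RealTorus) (h : HalfPeriod) :
    (SemidirectProduct.inl ε : GroupA) * minusBy h * (SemidirectProduct.inl ε)⁻¹ *
      (minusBy h)⁻¹ = SemidirectProduct.inl (ε ^ 2) := by
  rw [mul_inv_eq_iff_eq_mul, mul_inv_eq_iff_eq_mul]
  ext1
  · simp only [minusBy, SemidirectProduct.mul_left, SemidirectProduct.mul_right,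
      SemidirectProduct.left_inl, SemidirectProduct.right_inl, map_one, MulAut.one_apply,
      torusAut_neg_one, one_mul, sq]
    rw [mul_right_comm, mul_inv_cancel_right]
  · simp [minusBy, sq]

/-- The commutator of a translation by ε with z ↦ -z + h is translation by 2ε. It lies in G, so 2ε
is 2-torsion. -/
lemma pow_four_eq_one_of_mem_normalizer (t : OrbifoldType) {x : Fin 3 → GroupA}
    (hx : (SemidirectProduct.inl x : GroupA3) ∈ GroupH t) (hr : ∀ i, (x i).right = 1) :
    x ^ 4 = 1 := by
  funext i
  obtain ⟨y, h, hy, hyi⟩ := exists_minusBy t i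
  have hmem : SemidirectProduct.inl (x * y * x⁻¹ * y⁻¹) ∈ orbifoldGroup t := by
    simp only [map_mul, map_inv]
    exact mul_mem ((Subgroup.mem_normalizer_iff.1 hx _).1 hy) (inv_mem hy)
  have hC := inl_mem_signedTwoTorsionPi.1 (orbifoldGroup_le t hmem) i
  obtain ⟨ε, hε⟩ : ∃ ε, x i = SemidirectProduct.inl ε :=
    ⟨(x i).left, by ext1 <;> simp [hr i]⟩
  simp only [Pi.mul_apply, Pi.inv_apply, hε, hyi, inl_commutator_minusBy] at hC
  have h4 := hC.1
  rw [SemidirectProduct.left_inl, ← pow_mul] at h4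
  rw [Pi.pow_apply, hε, ← map_pow, h4, map_one, Pi.one_apply]

lemma inl_inr_mem_normalizer (t : OrbifoldType) (γ : Fin 3 → Gamma 2) :
    (SemidirectProduct.inl fun i => SemidirectProduct.inr (γ i).1 : GroupA3) ∈ GroupH t := by
  have hcent : ∀ b ∈ signedTwoTorsionPi, (SemidirectProduct.inl fun i =>
      SemidirectProduct.inr (γ i).1 : GroupA3) * b * (SemidirectProduct.inl fun i =>
      SemidirectProduct.inr (γ i).1 : GroupA3)⁻¹ = b := by
    rintro _ ⟨y, hy, rfl⟩
    rw [mul_inv_eq_iff_eq_mul, ← map_mul, ← map_mul]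
    congr 1
    funext i
    exact commute_inr_of_mem_signedTwoTorsion (γ i).2 (hy i (Set.mem_univ i))
  rw [GroupH]
  refine Subgroup.centralizer_le_normalizer _ (Subgroup.mem_centralizer_iff.2 fun b hb => ?_)
  exact (mul_inv_eq_iff_eq_mul.1 (hcent b (orbifoldGroup_le t hb))).symm

/-! ### Reduction of H' to Γ(2)³. -/

/-- The elements of `A³` normalizing `G`. -/
abbrev groupHPi (t : OrbifoldType) : Subgroup (Fin 3 → GroupA) :=
  (GroupH t).comap SemidirectProduct.inl

/-- The images in `SL(2, ℤ/2)³` of the elements of `A³` normalizing `G`. -/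
def groupHPiModTwo (t : OrbifoldType) :
    groupHPi t →* (Fin 3 → SpecialLinearGroup (Fin 2) (ZMod 2)) :=
  (MonoidHom.piMap fun _ => (SpecialLinearGroup.map (Int.castRingHom (ZMod 2))).comp
    SemidirectProduct.rightHom).comp (groupHPi t).subtype

namespace LiftsHomsMod

variable {p : ℕ}

lemma ker_groupHPiModTwo (hp : p.Coprime 2) (t : OrbifoldType) :
    LiftsHomsMod p (groupHPiModTwo t).ker := by
  let π : (groupHPiModTwo t).ker →* (Fin 3 → Gamma 2) :=
    MonoidHom.pi fun i => (SemidirectProduct.rightHom.comp ((Pi.evalMonoidHom _ i).comp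
      ((groupHPi t).subtype.comp (groupHPiModTwo t).ker.subtype))).codRestrict (Gamma 2) fun x =>
        congrFun x.2 i
  -- The section exists because Γ(2)³, embedded without translations, normalizes G.
  let s : (Fin 3 → Gamma 2) →* (groupHPiModTwo t).ker :=
    ((MonoidHom.piMap fun _ => SemidirectProduct.inr.comp (Gamma 2).subtype).codRestrict
      (groupHPi t) (inl_inr_mem_normalizer t)).codRestrict _ fun γ => funext fun i => (γ i).2
  refine .of_split π s (fun _ => rfl) (n := 4) (hp.pow_right 2) ?_ (.pi fun _ => gamma_two hp)
  intro x hx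
  apply Subtype.ext
  apply Subtype.ext
  exact pow_four_eq_one_of_mem_normalizer t x.1.2 fun i => congrArg Subtype.val (congrFun hx i)

lemma groupH (hp2 : p.Coprime 2) (hp3 : p.Coprime 3) (t : OrbifoldType) :
    LiftsHomsMod p (GroupH t) := by
  have hp6 : p.Coprime 6 := hp2.mul_right hp3
  let φ : GroupH t →* Equiv.Perm (Fin 3) := SemidirectProduct.rightHom.comp (GroupH t).subtype
  refine .of_ker φ ?_ ?_
  · rwa [Nat.card_eq_fintype_card, Fintype.card_perm, Fintype.card_fin]
  let j : groupHPi t →* φ.ker :=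
    ((SemidirectProduct.inl.comp (groupHPi t).subtype).codRestrict (GroupH t)
      fun x => x.2).codRestrict _ fun x => rfl
  -- The kernel of the projection to S₃ is the normalizer of G inside A³.
  have hj : Function.Bijective j := by
    refine ⟨fun x y h => ?_, fun y => ?_⟩
    · exact Subtype.ext (SemidirectProduct.inl_injective
        (congrArg (fun z : φ.ker => z.1.1) h))
    · have hy : SemidirectProduct.inl y.1.1.left = y.1.1 := by
        ext1
        · simp
        · exact y.2.symm
      refine ⟨⟨y.1.1.left, ?_⟩, Subtype.ext (Subtype.ext hy)⟩
      rw [Subgroup.mem_comap, hy]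
      exact y.1.2
  refine .of_mulEquiv (MulEquiv.ofBijective j hj).symm (.of_ker (groupHPiModTwo t) ?_
    (ker_groupHPiModTwo hp2 t))
  rw [Nat.card_pi, Finset.prod_const]
  refine Nat.Coprime.pow_right _ ?_
  have : Nat.card (SpecialLinearGroup (Fin 2) (ZMod 2)) = 6 := by
    rw [Nat.card_eq_fintype_card]
    decide
  rwa [this]

lemma groupHPrime (hp2 : p.Coprime 2) (hp3 : p.Coprime 3) (t : OrbifoldType) :
    LiftsHomsMod p (GroupHPrime t) := by
  refine .quotient _ two_ne_zero (fun x hx => ?_) (groupH hp2 hp3 t)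
  obtain ⟨y, hy, hxy⟩ := orbifoldGroup_le t (Subgroup.mem_subgroupOf.1 hx)
  apply Subtype.ext
  rw [Subgroup.coe_pow, ← hxy, ← map_pow, Subgroup.coe_one, ← map_one SemidirectProduct.inl]
  congr 1
  funext i
  exact sq_eq_one_of_mem_signedTwoTorsion (hy i (Set.mem_univ i))

end LiftsHomsMod

theorem corollary6p11 (t : OrbifoldType) (p : ℕ) (hp : p.Prime) (hp3 : 3 < p)
    (x : groupCohomology (Rep.trivial ℤ (GroupHPrime t) ℤ) 2) (hx : p • x = 0) :
    x = 0 :=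
  LiftsHomsMod.groupCohomology_two_eq_zero hp.ne_zero
    (LiftsHomsMod.groupHPrime ((Nat.coprime_primes hp Nat.prime_two).2 (by omega))
      ((Nat.coprime_primes hp Nat.prime_three).2 (by omega)) t) x hx
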